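/- For a complex Banach space $X\neq\{0\}$ and an integer $k\ge 1$, a map $P:X\to X$ is a continuous $k$-homogeneous polynomial if $P(x)=A(x,\dots,x)$ for some continuous $k$-linear map $A:X^k\to X$. Put $\|P\|=\sup_{\|x\|\le 1}\|P(x)\|$, let $$v(P)=\sup\{|x^*(P(x))| : x\in X,\ x^*\in X^*,\ \|x\|=\|x^*\|=x^*(x)=1\}$$ be its numerical radius, and let $$n^{(k)}(X)=\inf\{v(P) : P \text{ a continuous } k\text{-homogeneous polynomial on } X,\ \|P\|=1\}$$ be the polynomial numerical index of order $k$ of $X$. There are two-dimensional complex Banach spaces $X_k$ ($k\ge 2$) with $n^{(k)}(X_k)=\exp\left(\frac{k\log k}{1-k}\right)$ for each $k\geq 2$, such that the $c_0$-sum $X=\left[\oplus_{k\ge 2}X_k\right]_{c_0}$ (the sequences $(x_k)$ with $x_k\in X_k$ and $\|x_k\|\to 0$, under the supremum norm) is a complex Banach space satisfying $$n^{(k)}(X)=\exp\left(\frac{k\log k}{1-k}\right)\qquad\text{for every } k\ge 2 .$$ Moreover, every complex Banach space $Y\ne\{0\}$ satisfies Harris's lower bound $n^{(k)}(Y)\ge\exp\left(\frac{k\log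 k}{1-k}\right)$ for every $k\ge 2$; thus all these lower bounds are attained simultaneously by the single space $X$. -/

import Mathlib

open Filter Topology
open scoped ENNReal

noncomputable section

namespace PolyNumIndex


/-- `P : X → X` is a continuous `k`-homogeneous polynomial: the restriction to the diagonal of a
continuous `k`-linear map. -/
def IsHomPoly (𝕜 : Type*) [RCLike 𝕜] {X : Type*} [NormedAddCommGroup X] [NormedSpace 𝕜 X]
    (k : ℕ) (P : X → X) : Prop :=
  ∃ A : ContinuousMultilinearMap 𝕜 (fun _ : Fin k => X) X, ∀ x, P x = A (fun _ => x)

/-- The norm of a polynomial: the supremum of `‖P x‖` over the closed unit ball. -/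
def polyNorm {X : Type*} [NormedAddCommGroup X] (P : X → X) : ℝ :=
  sSup {r : ℝ | ∃ x : X, ‖x‖ ≤ 1 ∧ r = ‖P x‖}

/-- The numerical range `V(P) = {x*(P x) : x ∈ S_X, x* ∈ S_{X*}, x*(x) = 1}`. -/
def numRange (𝕜 : Type*) [RCLike 𝕜] {X : Type*} [NormedAddCommGroup X] [NormedSpace 𝕜 X]
    (P : X → X) : Set 𝕜 :=
  {c : 𝕜 | ∃ (x : X) (f : StrongDual 𝕜 X), ‖x‖ = 1 ∧ ‖f‖ = 1 ∧ f x = 1 ∧ c = f (P x)}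

/-- The numerical radius `v(P) = sup {|c| : c ∈ V(P)}`. -/
def numRadius (𝕜 : Type*) [RCLike 𝕜] {X : Type*} [NormedAddCommGroup X] [NormedSpace 𝕜 X]
    (P : X → X) : ℝ :=
  sSup {r : ℝ | ∃ c ∈ numRange 𝕜 P, r = ‖c‖}

/-- The polynomial numerical index of order `k`: the infimum of `v(P)` over the continuous
`k`-homogeneous polynomials `P : X → X` of norm one. -/
def polyIndex (𝕜 : Type*) [RCLike 𝕜] (k : ℕ) (X : Type*) [NormedAddCommGroup X]
    [NormedSpace 𝕜 X] : ℝ :=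
  sInf {r : ℝ | ∃ P : X → X, IsHomPoly 𝕜 k P ∧ polyNorm P = 1 ∧ r = numRadius 𝕜 P}


/-- The `c₀`-sum of a family of normed spaces: the families `x` with `‖x i‖ → 0` along the
cofinite filter, with the supremum norm (as a subspace of the `ℓ_∞`-sum). -/
def c0Sum (𝕜 : Type*) [RCLike 𝕜] {ι : Type*} (E : ι → Type*) [∀ i, NormedAddCommGroup (E i)]
    [∀ i, NormedSpace 𝕜 (E i)] : Submodule 𝕜 (lp E ∞) where
  carrier := {x | Tendsto (fun i => ‖x i‖) cofinite (𝓝 0)}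
  zero_mem' := by simpa using (tendsto_const_nhds : Tendsto (fun _ : ι => (0 : ℝ)) cofinite (𝓝 0))
  add_mem' {x y} hx hy := by
    have h : Tendsto (fun i => ‖x i‖ + ‖y i‖) cofinite (𝓝 0) := by
      simpa using Tendsto.add hx hy
    exact squeeze_zero (fun _ => norm_nonneg _) (fun i => norm_add_le (x i) (y i)) h
  smul_mem' c x hx := by
    have h : Tendsto (fun i => ‖c‖ * ‖x i‖) cofinite (𝓝 0) := by
      simpa using Tendsto.const_mul ‖c‖ hx
    exact squeeze_zero (fun _ => norm_nonneg _) (fun i => (norm_smul c (x i)).le) h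

end PolyNumIndex

end

/-! Both bounds compare the flow `x' = P x` with the scalar equation `y' = v y ^ k`, `y 0 = 1`,
whose solution satisfies `y ^ (k - 1) * (1 - (k - 1) v t) = 1`.

Lower bound: a functional supporting `z` shows that `v = numRadius P` controls the growth of the
norm along the flow in every complex time direction. The Euler iterates therefore stay below the
scalar solution. They are holomorphic in the complex step, with derivative `N • P x` at step zero,
so Cauchy's estimate gives `‖P x‖ ≤ y r / r` for any `v` above the numerical radius. The best time
`r = 1 / (k v)` gives `y r = k ^ (1 / (k - 1))`, which is Harris's bound
(`IsHomPoly.norm_apply_le_numRadius`).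

Sharpness: for `P (x, y) = (0, x ^ k)` the flow is the shear `(x, y + t x ^ k)`. With `q = |x|`, `p
= |y|`, the unit sphere is chosen to contain the arc `(k - 1) v p = q - q ^ k` for `q` between `1 /
M` and `1`, where `M = extremalRadius k`, closed off by `p = 1` for `q ≤ 1 / M`. The shear at time
`t ≥ 0` carries the curve onto its dilate by `y t`, so `P` grows no faster than the scalar flow
(`weighted_shear_le`). The resulting `GrowthBound` bounds the numerical radius, and it survives in a
`c₀`-sum because the lifted polynomial alters only one coordinate. -/

namespace PolyNumIndex

/-! ### The constants of Harris's bound -/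

/-- The radius `k ^ (1 / (k - 1))`. -/
noncomputable def extremalRadius (k : ℕ) : ℝ := Real.exp (Real.log k / (k - 1))

/-- Harris's constant `k ^ (k / (1 - k))`. -/
noncomputable def harrisConst (k : ℕ) : ℝ := Real.exp ((k : ℝ) * Real.log (k : ℝ) / (1 - (k : ℝ)))

theorem extremalRadius_pow_pred {k : ℕ} (hk : 2 ≤ k) : extremalRadius k ^ (k - 1) = k := by
  have h2 : (2 : ℝ) ≤ k := by exact_mod_cast hk
  rw [extremalRadius, ← Real.exp_nat_mul, Nat.cast_sub (by omega), Nat.cast_one,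
    mul_div_cancel₀ _ (by linarith), Real.exp_log (by linarith)]

theorem one_le_extremalRadius {k : ℕ} (hk : 2 ≤ k) : 1 ≤ extremalRadius k := by
  have h2 : (2 : ℝ) ≤ k := by exact_mod_cast hk
  exact Real.one_le_exp (div_nonneg (Real.log_nonneg (by linarith)) (by linarith))

theorem extremalRadius_pow {k : ℕ} (hk : 2 ≤ k) :
    extremalRadius k ^ k = extremalRadius k * k := by
  rw [← mul_pow_sub_one (by omega), extremalRadius_pow_pred hk]

theorem harrisConst_pos (k : ℕ) : 0 < harrisConst k := Real.exp_pos _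

theorem harrisConst_mul_extremalRadius_pow {k : ℕ} (hk : 2 ≤ k) :
    harrisConst k * extremalRadius k ^ k = 1 := by
  have h2 : (2 : ℝ) ≤ k := by exact_mod_cast hk
  have h3 : (k : ℝ) - 1 ≠ 0 := by linarith
  have h4 : 1 - (k : ℝ) ≠ 0 := by linarith
  rw [harrisConst, extremalRadius, ← Real.exp_nat_mul, ← Real.exp_add, Real.exp_eq_one_iff]
  field_simp
  ring

/-! ### The numerical radius controls first-order growth -/

section Bounds

variable {X : Type*} [NormedAddCommGroup X] [NormedSpace ℂ X] {k : ℕ} {P : X → X}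

theorem IsHomPoly.exists_norm_le (hP : IsHomPoly ℂ k P) :
    ∃ C, 0 ≤ C ∧ ∀ x, ‖P x‖ ≤ C * ‖x‖ ^ k := by
  obtain ⟨A, hA⟩ := hP
  exact ⟨‖A‖, norm_nonneg _, fun x => by simpa [hA] using A.le_opNorm fun _ => x⟩

theorem IsHomPoly.apply_smul (hP : IsHomPoly ℂ k P) (c : ℂ) (x : X) : P (c • x) = c ^ k • P x := by
  obtain ⟨A, hA⟩ := hP
  rw [hA, hA]
  simpa using A.map_smul_univ (fun _ => c) fun _ => x

theorem IsHomPoly.differentiable (hP : IsHomPoly ℂ k P) : Differentiable ℂ P := by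
  obtain ⟨A, hA⟩ := hP
  rw [funext hA]
  exact ((A.contDiff (n := 1)).comp (contDiff_pi.2 fun _ => contDiff_id)).differentiable
    (by norm_num)

theorem IsHomPoly.exists_lipschitz_on_ball (hP : IsHomPoly ℂ k P) (R : ℝ) :
    ∃ C, 0 ≤ C ∧ ∀ x y, ‖x‖ ≤ R → ‖y‖ ≤ R → ‖P x - P y‖ ≤ C * ‖x - y‖ := by
  obtain ⟨A, hA⟩ := hP
  refine ⟨‖A‖ * k * |R| ^ (k - 1), by positivity, fun x y hx hy => ?_⟩
  have h := A.norm_image_sub_le (fun _ => x) fun _ => y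
  have hc : ∀ z : X, ‖fun _ : Fin k => z‖ ≤ ‖z‖ := fun z =>
    (pi_norm_le_iff_of_nonneg (norm_nonneg z)).2 fun _ => le_rfl
  rw [← hA, ← hA, Fintype.card_fin] at h
  refine h.trans ?_
  gcongr
  · exact max_le (((hc x).trans hx).trans (le_abs_self R)) (((hc y).trans hy).trans (le_abs_self R))
  · exact hc (x - y)

theorem numRadius_nonneg (P : X → X) : 0 ≤ numRadius ℂ P :=
  Real.sSup_nonneg (by rintro _ ⟨c, -, rfl⟩; exact norm_nonneg c)

theorem IsHomPoly.norm_dual_apply_le_numRadius (hP : IsHomPoly ℂ k P) {x : X}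
    {f : StrongDual ℂ X} (hx : ‖x‖ = 1) (hf : ‖f‖ = 1) (hfx : f x = 1) :
    ‖f (P x)‖ ≤ numRadius ℂ P := by
  obtain ⟨C, -, hCP⟩ := hP.exists_norm_le
  refine le_csSup ⟨C, ?_⟩ ⟨_, ⟨x, f, hx, hf, hfx, rfl⟩, rfl⟩
  rintro _ ⟨_, ⟨y, g, hy, hg, -, rfl⟩, rfl⟩
  calc ‖g (P y)‖ ≤ ‖g‖ * ‖P y‖ := g.le_opNorm _
    _ ≤ C := by simpa [hg, hy] using hCP y

theorem IsHomPoly.norm_dual_apply_le (hP : IsHomPoly ℂ k P) {x : X} {f : StrongDual ℂ X}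
    (hx : x ≠ 0) (hf : ‖f‖ = 1) (hfx : f x = ‖x‖) :
    ‖f (P x)‖ ≤ numRadius ℂ P * ‖x‖ ^ k := by
  have hx0 : (‖x‖ : ℂ) ≠ 0 := by simpa using hx
  have h := hP.norm_dual_apply_le_numRadius (x := (‖x‖ : ℂ)⁻¹ • x) (f := f)
    (by simp [norm_smul, hx]) hf (by simp [hfx, hx0])
  have h1 : 0 < ‖x‖ := norm_pos_iff.2 hx
  rw [hP.apply_smul, map_smul, norm_smul, norm_pow, norm_inv, Complex.norm_real, norm_norm,
    inv_pow, inv_mul_le_iff₀ (by positivity)] at h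
  linarith

/-- The map `z ↦ z - h • P z` does not contract faster than the numerical radius allows. -/
theorem IsHomPoly.norm_sub_le_norm_sub_smul (hP : IsHomPoly ℂ k P) (z : X) (h : ℂ) :
    ‖z‖ - ‖h‖ * (numRadius ℂ P * ‖z‖ ^ k) ≤ ‖z - h • P z‖ := by
  rcases eq_or_ne z 0 with rfl | hz
  · have h0 : 0 ≤ ‖h‖ * (numRadius ℂ P * ‖(0 : X)‖ ^ k) :=
      mul_nonneg (norm_nonneg _) (mul_nonneg (numRadius_nonneg P) (by positivity))
    rw [norm_zero] at h0 ⊢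
    linarith [norm_nonneg (0 - h • P (0 : X))]
  · obtain ⟨f, hf, hfz⟩ := exists_dual_vector ℂ z (norm_ne_zero_iff.2 hz)
    have h1 : ‖f (z - h • P z)‖ ≤ ‖z - h • P z‖ := by
      simpa [hf] using f.le_opNorm (z - h • P z)
    have h2 : ‖f z‖ - ‖h • f (P z)‖ ≤ ‖f (z - h • P z)‖ := by
      rw [map_sub, map_smul]
      exact norm_sub_norm_le _ _
    rw [hfz, norm_smul] at h2
    have h3 := hP.norm_dual_apply_le hz hf hfz
    have h5 := mul_le_mul_of_nonneg_left h3 (norm_nonneg h)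
    have h6 : ‖(RCLike.ofReal ‖z‖ : ℂ)‖ = ‖z‖ := by simp
    rw [h6] at h2
    linarith

/-- One step of the explicit Euler scheme for `x' = P x`. -/
theorem IsHomPoly.exists_norm_add_smul_le (hP : IsHomPoly ℂ k P) {R ε : ℝ} (hR : 0 ≤ R)
    (hε : 0 < ε) :
    ∃ δ > 0, ∀ x : X, ‖x‖ ≤ R → ∀ h : ℂ, ‖h‖ ≤ δ →
      ‖x + h • P x‖ ≤ ‖x‖ + ‖h‖ * (numRadius ℂ P * ‖x‖ ^ k + ε) := by
  obtain ⟨C, hC0, hC⟩ := hP.exists_norm_le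
  set V := numRadius ℂ P with hV
  have hV0 : 0 ≤ V := numRadius_nonneg P
  set D := C * R ^ k with hD
  have hD0 : 0 ≤ D := by positivity
  obtain ⟨L, hL0, hL⟩ := hP.exists_lipschitz_on_ball (R + D)
  -- `K` bounds the coefficient of the second-order error in `h`, uniformly on the ball of radius
  -- `R`.
  set K := L * D + V * (D * k * (R + D) ^ (k - 1)) with hK
  have hK0 : 0 ≤ K := by positivity
  refine ⟨min 1 (ε / (K + 1)), by positivity, fun x hx h hh => ?_⟩
  have hh1 : ‖h‖ ≤ 1 := hh.trans (min_le_left _ _)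
  have hhK : ‖h‖ * K ≤ ε := by
    have := hh.trans (min_le_right _ _)
    rw [le_div_iff₀ (by positivity)] at this
    nlinarith [norm_nonneg h]
  have hPx : ‖P x‖ ≤ D := (hC x).trans (by rw [hD]; gcongr)
  set z := x + h • P x with hz
  have hzx : ‖z - x‖ ≤ ‖h‖ * D := by
    rw [hz, add_sub_cancel_left, norm_smul]
    gcongr
  have hzR : ‖z‖ ≤ R + D := by
    have := norm_add_le x (z - x)
    rw [add_sub_cancel] at this
    nlinarith
  -- The supporting functional is taken at the endpoint `z`: stepping back from `z` returns to `x`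
  -- up to order `‖h‖ ^ 2`, so a lower bound for the backward step is an upper bound for `‖z‖`.
  have h1 := hP.norm_sub_le_norm_sub_smul z h
  have h2 : ‖z - h • P z‖ ≤ ‖x‖ + ‖h‖ * (L * (‖h‖ * D)) := by
    have e : z - h • P z = x + h • (P x - P z) := by rw [hz, smul_sub]; abel
    rw [e]
    refine (norm_add_le _ _).trans ?_
    rw [norm_smul]
    gcongr
    refine (hL x z (by linarith) hzR).trans ?_
    rw [norm_sub_rev]
    gcongr
  have h3 : ‖z‖ ^ k ≤ ‖x‖ ^ k + ‖h‖ * D * k * (R + D) ^ (k - 1) := by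
    have h4 := (le_abs_self _).trans (abs_pow_sub_pow_le ‖z‖ ‖x‖ k)
    have h5 : |‖z‖ - ‖x‖| * k * max |‖z‖| |‖x‖| ^ (k - 1) ≤
        ‖h‖ * D * k * (R + D) ^ (k - 1) := by
      gcongr
      · exact (abs_norm_sub_norm_le z x).trans hzx
      · rw [abs_norm, abs_norm]
        exact max_le hzR (by linarith)
    linarith
  have h6 : V * ‖z‖ ^ k ≤ V * (‖x‖ ^ k + ‖h‖ * D * k * (R + D) ^ (k - 1)) := by gcongr
  have h7 := mul_le_mul_of_nonneg_left h6 (norm_nonneg h)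
  have h8 := mul_le_mul_of_nonneg_left hhK (norm_nonneg h)
  rw [hK] at h8
  linarith

end Bounds

/-! ### The scalar comparison equation -/

/-- The Euler scheme for `y' = w y ^ k`, `y 0 = 1`, with step `h`. -/
noncomputable def scalarEuler (k : ℕ) (w h : ℝ) : ℕ → ℝ
  | 0 => 1
  | n + 1 => scalarEuler k w h n + h * (w * scalarEuler k w h n ^ k)

theorem one_le_scalarEuler (k : ℕ) {w h : ℝ} (hw : 0 ≤ w) (hh : 0 ≤ h) (n : ℕ) :
    1 ≤ scalarEuler k w h n := by
  induction n with
  | zero => exact le_rfl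
  | succ n ih =>
    rw [scalarEuler]
    have : 0 ≤ h * (w * scalarEuler k w h n ^ k) := by positivity
    linarith

/-- Bernoulli bounds the second factor by `(1 - d) ^ n`. This is the discrete form of the convexity
that keeps an Euler step below the exact solution. -/
theorem one_add_pow_mul_one_sub_le (n : ℕ) {d : ℝ} (hd : 0 ≤ d) (hnd : n * d ≤ 1) :
    (1 + d) ^ n * (1 - n * d) ≤ 1 := by
  rcases Nat.eq_zero_or_pos n with rfl | hn
  · simp
  have hn1 : (1 : ℝ) ≤ n := by exact_mod_cast hn
  have hd1 : d ≤ 1 := by nlinarith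
  have h1 : 1 - n * d ≤ (1 - d) ^ n := by
    have := one_add_mul_le_pow (a := -d) (by linarith) n
    rw [← sub_eq_add_neg] at this
    linarith
  calc (1 + d) ^ n * (1 - n * d) ≤ (1 + d) ^ n * (1 - d) ^ n := by gcongr
    _ = (1 - d ^ 2) ^ n := by rw [← mul_pow]; ring
    _ ≤ 1 := pow_le_one₀ (by nlinarith) (by nlinarith)

/-- The Euler scheme stays below the exact solution of `y' = w y ^ k`. -/
theorem scalarEuler_pow_mul_le {k : ℕ} (hk : 2 ≤ k) {w h : ℝ} (hw : 0 ≤ w) (hh : 0 ≤ h) (n : ℕ)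
    (hn : ((k - 1 : ℕ) : ℝ) * w * (n * h) ≤ 1) :
    scalarEuler k w h n ^ (k - 1) * (1 - ((k - 1 : ℕ) : ℝ) * w * (n * h)) ≤ 1 := by
  induction n with
  | zero => simp [scalarEuler]
  | succ n ih =>
    push_cast at hn ⊢
    set c : ℝ := ((k - 1 : ℕ) : ℝ) with hc
    have hc0 : 0 ≤ c := Nat.cast_nonneg _
    have hstep : 0 ≤ c * w * h := by positivity
    have ih' := ih (by nlinarith)
    set b := scalarEuler k w h n with hb
    have hb1 : 1 ≤ b := one_le_scalarEuler k hw hh n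
    set u := 1 - c * w * (n * h) with hu
    rcases hn.eq_or_lt with hn' | hn'
    · have : 1 - c * w * ((n + 1) * h) = 0 := by linarith
      rw [this, mul_zero]
      exact zero_le_one
    have hupos : 0 < u := by rw [hu]; nlinarith
    have e : scalarEuler k w h (n + 1) = b * (1 + h * w * b ^ (k - 1)) := by
      rw [scalarEuler, ← hb, ← mul_pow_sub_one (by omega : k ≠ 0) b]
      ring
    -- By induction `b ^ (k - 1) ≤ 1 / u`, so `d` bounds the relative increment of this step.
    set d := h * w / u with hd
    have hd0 : 0 ≤ d := by positivity
    have hud : u * d = h * w := by rw [hd]; field_simp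
    have hcd : c * d ≤ 1 := by
      have : u * (c * d) ≤ u * 1 := by
        rw [mul_left_comm, hud, mul_one, hu]; nlinarith
      exact le_of_mul_le_mul_left this hupos
    have hbd : h * w * b ^ (k - 1) ≤ d := by
      rw [hd, le_div_iff₀ hupos]
      have : h * w * (b ^ (k - 1) * u) ≤ h * w * 1 := by gcongr
      linarith
    have e2 : 1 - c * w * ((n + 1) * h) = u * (1 - c * d) := by
      have : u * (1 - c * d) = u - c * (u * d) := by ring
      rw [this, hud, hu]; ring
    rw [e, e2, mul_pow]
    calc b ^ (k - 1) * (1 + h * w * b ^ (k - 1)) ^ (k - 1) * (u * (1 - c * d))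
        = (b ^ (k - 1) * u) * ((1 + h * w * b ^ (k - 1)) ^ (k - 1) * (1 - c * d)) := by ring
      _ ≤ 1 * ((1 + d) ^ (k - 1) * (1 - c * d)) := by
        have : 0 ≤ 1 - c * d := by linarith
        gcongr
      _ ≤ 1 := by
        rw [one_mul]
        exact one_add_pow_mul_one_sub_le (k - 1) hd0 hcd

/-! ### Harris's lower bound by Cauchy's estimate -/

section Euler

variable {X : Type*} [NormedAddCommGroup X] [NormedSpace ℂ X]

/-- The Euler scheme for `x' = P x` with step `h`, started at `x`. -/
noncomputable def euler (P : X → X) (x : X) (h : ℂ) : ℕ → X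
  | 0 => x
  | n + 1 => euler P x h n + h • P (euler P x h n)

theorem euler_zero_step (P : X → X) (x : X) (n : ℕ) : euler P x 0 n = x := by
  induction n with
  | zero => rfl
  | succ n ih => rw [euler, ih, zero_smul, add_zero]

variable {k : ℕ} {P : X → X}

theorem IsHomPoly.differentiable_euler (hP : IsHomPoly ℂ k P) (x : X) (n : ℕ) :
    Differentiable ℂ fun h => euler P x h n := by
  induction n with
  | zero => exact differentiable_const x
  | succ n ih => exact ih.add (differentiable_id.smul (hP.differentiable.comp ih))

/-- At step zero every iterate equals `x`, so each of the `n` steps contributes exactly `P x`. -/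
theorem IsHomPoly.hasDerivAt_euler (hP : IsHomPoly ℂ k P) (x : X) (n : ℕ) :
    HasDerivAt (fun h => euler P x h n) ((n : ℂ) • P x) 0 := by
  induction n with
  | zero => simpa [euler] using hasDerivAt_const (0 : ℂ) x
  | succ n ih =>
    have h1 : HasDerivAt (fun h => P (euler P x h n))
        (deriv (fun h => P (euler P x h n)) 0) 0 :=
      ((hP.differentiable.comp (hP.differentiable_euler x n)) 0).hasDerivAt
    have h2 := ih.add ((hasDerivAt_id (0 : ℂ)).smul h1)
    convert! h2 using 1
    simp [euler_zero_step, add_smul]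

/-- Harris's estimate `‖P x‖ ≤ k ^ (k / (k - 1)) v(P)` on the unit ball. -/
theorem IsHomPoly.norm_apply_le_numRadius (hk : 2 ≤ k) (hP : IsHomPoly ℂ k P) {x : X}
    (hx : ‖x‖ ≤ 1) : ‖P x‖ ≤ numRadius ℂ P * extremalRadius k ^ k := by
  set V := numRadius ℂ P with hV
  have hV0 : 0 ≤ V := numRadius_nonneg P
  set M := extremalRadius k with hM
  have hM1 : 1 ≤ M := one_le_extremalRadius hk
  have hk2 : (2 : ℝ) ≤ k := by exact_mod_cast hk
  -- The gap `w - V` absorbs the Euler error, and `w > 0` keeps the time `1 / (k * w)` meaningful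
  -- when `V = 0`.
  suffices h : ∀ w, V < w → ‖P x‖ ≤ w * M ^ k by
    have h0 : 0 < M ^ k := by positivity
    rw [← div_le_iff₀ h0]
    exact le_of_forall_gt_imp_ge_of_dense fun w hw => (div_le_iff₀ h0).2 (h w hw)
  intro w hw
  have hw0 : 0 < w := hV0.trans_lt hw
  obtain ⟨δ, hδ, hstep⟩ := hP.exists_norm_add_smul_le (R := M) (ε := w - V) (by linarith)
    (by linarith)
  -- The time minimizing `y r / r` for the solution of `y' = w y ^ k`; there `y r ^ (k - 1) = k`.
  set r := 1 / (k * w) with hr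
  have hr0 : 0 < r := by positivity
  obtain ⟨N, hN⟩ := exists_nat_gt (r / δ)
  have hN0 : (0 : ℝ) < N := (by positivity : (0 : ℝ) ≤ r / δ).trans_lt hN
  set h := r / N with hh
  have hh0 : 0 < h := by positivity
  have hhδ : h ≤ δ := by
    rw [div_lt_iff₀ hδ] at hN
    rw [hh, div_le_iff₀ hN0]
    linarith
  have hNh : N * h = r := by rw [hh]; field_simp
  have hck : ((k - 1 : ℕ) : ℝ) = k - 1 := by rw [Nat.cast_sub (by omega), Nat.cast_one]
  have hcr : ((k - 1 : ℕ) : ℝ) * w * r = 1 - 1 / k := by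
    rw [hck, hr]; field_simp
  have hbM : ∀ n ≤ N, scalarEuler k w h n ≤ M := by
    intro n hn
    have hnN : (n : ℝ) * h ≤ r := by rw [← hNh]; gcongr
    have h1 : ((k - 1 : ℕ) : ℝ) * w * (n * h) ≤ 1 - 1 / k := by rw [← hcr]; gcongr
    have h2 : 0 < 1 / (k : ℝ) := by positivity
    have h3 := scalarEuler_pow_mul_le hk hw0.le hh0.le n (by linarith)
    have hb1 := one_le_scalarEuler k hw0.le hh0.le n
    refine le_of_pow_le_pow_left₀ (by omega : k - 1 ≠ 0) (by linarith) ?_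
    rw [hM, extremalRadius_pow_pred hk]
    have h4 : scalarEuler k w h n ^ (k - 1) * (1 / k) ≤ 1 :=
      le_trans (by gcongr; linarith) h3
    rwa [mul_one_div, div_le_one (by positivity)] at h4
  have hE : ∀ t : ℂ, ‖t‖ = h → ∀ n ≤ N, ‖euler P x t n‖ ≤ scalarEuler k w h n := by
    intro t ht n
    induction n with
    | zero => intro _; simpa [euler, scalarEuler] using hx
    | succ n ih =>
      intro hn
      have ih' := ih (by omega)
      have hb1 := one_le_scalarEuler k hw0.le hh0.le n
      set b := scalarEuler k w h n with hb
      have h1 := hstep (euler P x t n) (ih'.trans (hbM n (by omega))) t (by rw [ht]; exact hhδ)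
      rw [euler, scalarEuler, ← hb]
      refine h1.trans ?_
      rw [ht]
      have h2 : ‖euler P x t n‖ ^ k ≤ b ^ k := by gcongr
      have h3 : 1 ≤ b ^ k := one_le_pow₀ hb1
      -- The scalar scheme starts at `1` and never drops below it, so the error `w - V` is at most
      -- `(w - V) * b ^ k`.
      have h4 : V * ‖euler P x t n‖ ^ k + (w - V) ≤ w * b ^ k := by
        have := mul_le_mul_of_nonneg_left h2 hV0
        nlinarith
      gcongr
  have hC := Complex.norm_deriv_le_of_forall_mem_sphere_norm_le (c := 0) (R := h) (C := M) hh0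
    (hP.differentiable_euler x N).diffContOnCl fun t ht =>
      (hE t (by simpa using ht) N le_rfl).trans (hbM N le_rfl)
  rw [(hP.hasDerivAt_euler x N).deriv, norm_smul, Complex.norm_natCast, le_div_iff₀ hh0] at hC
  have h5 : ‖P x‖ * r ≤ M := by rw [← hNh]; linarith
  rw [hr, mul_one_div, div_le_iff₀ (by positivity)] at h5
  rw [hM, extremalRadius_pow hk, ← hM]
  linarith

/-- Harris's lower bound for the numerical radius of a polynomial of norm one. -/
theorem IsHomPoly.harrisConst_le_numRadius (hk : 2 ≤ k) (hP : IsHomPoly ℂ k P)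
    (hP1 : polyNorm P = 1) : harrisConst k ≤ numRadius ℂ P := by
  have h1 : polyNorm P ≤ numRadius ℂ P * extremalRadius k ^ k := by
    refine csSup_le ⟨_, 0, by simp, rfl⟩ ?_
    rintro _ ⟨x, hx, rfl⟩
    exact hP.norm_apply_le_numRadius hk hx
  rw [hP1, ← harrisConst_mul_extremalRadius_pow hk] at h1
  exact le_of_mul_le_mul_right h1 (pow_pos (Real.exp_pos _) k)

theorem polyNorm_eq_one {Y : Type*} [NormedAddCommGroup Y] {P : Y → Y}
    (hP : ∀ x, ‖x‖ ≤ 1 → ‖P x‖ ≤ 1) (hP1 : ∃ x, ‖x‖ ≤ 1 ∧ ‖P x‖ = 1) : polyNorm P = 1 := by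
  obtain ⟨x, hx, hx1⟩ := hP1
  refine IsGreatest.csSup_eq ⟨⟨x, hx, hx1.symm⟩, ?_⟩
  rintro _ ⟨y, hy, rfl⟩
  exact hP y hy

/-- Every nontrivial normed space carries a `k`-homogeneous polynomial of norm one,
`x ↦ f x ^ k • x₀`. -/
theorem exists_isHomPoly_polyNorm_eq_one (X : Type*) [NormedAddCommGroup X] [NormedSpace ℂ X]
    [Nontrivial X] (k : ℕ) : ∃ P : X → X, IsHomPoly ℂ k P ∧ polyNorm P = 1 := by
  obtain ⟨y, hy⟩ := exists_ne (0 : X)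
  obtain ⟨x₀, hx₀⟩ : ∃ x₀ : X, ‖x₀‖ = 1 :=
    ⟨(‖y‖ : ℂ)⁻¹ • y, by simp [norm_smul, hy]⟩
  obtain ⟨f, hf, hfx⟩ := exists_dual_vector ℂ x₀ (by simp [hx₀])
  have hfx1 : f x₀ = 1 := by rw [hfx, hx₀]; simp
  refine ⟨fun x => f x ^ k • x₀,
    ⟨((ContinuousMultilinearMap.mkPiAlgebraFin ℂ k ℂ).compContinuousLinearMap
      fun _ => f).smulRight x₀, fun x => by simp⟩,
    polyNorm_eq_one (fun x hx => ?_) ⟨x₀, hx₀.le, by simp [hfx1, hx₀]⟩⟩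
  rw [norm_smul, norm_pow, hx₀, mul_one]
  exact pow_le_one₀ (norm_nonneg _) ((f.le_opNorm x).trans (by rw [hf, one_mul]; exact hx))

theorem harrisConst_le_polyIndex (X : Type*) [NormedAddCommGroup X] [NormedSpace ℂ X]
    [Nontrivial X] {k : ℕ} (hk : 2 ≤ k) : harrisConst k ≤ polyIndex ℂ k X := by
  -- An admissible polynomial is needed because the real infimum of the empty set is `0`.
  obtain ⟨P, hP, hP1⟩ := exists_isHomPoly_polyNorm_eq_one X k
  refine le_csInf ⟨_, P, hP, hP1, rfl⟩ ?_
  rintro _ ⟨Q, hQ, hQ1, rfl⟩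
  exact hQ.harrisConst_le_numRadius hk hQ1

end Euler

/-! ### Growth bounds and the numerical radius -/

section Growth

variable {X : Type*} [NormedAddCommGroup X] [NormedSpace ℂ X] {k : ℕ} {P : X → X}

/-- `P` moves the unit ball, to first order, no faster than the flow of `y' = v y ^ (n + 1)`. -/
def GrowthBound (n : ℕ) (v : ℝ) (P : X → X) : Prop :=
  ∀ x, ‖x‖ ≤ 1 → ∀ h : ℂ, n * v * ‖h‖ ≤ 1 → ‖x + h • P x‖ ^ n * (1 - n * v * ‖h‖) ≤ 1

/-- A value `c` of the numerical range gives growth at rate `‖c‖` once the phase of `h` is aligned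
with it; comparing first-order terms for small `‖h‖` excludes `‖c‖ > v`. -/
theorem GrowthBound.numRadius_le {n : ℕ} (hn : n ≠ 0) {v : ℝ} (hv : 0 ≤ v)
    (hP : GrowthBound n v P) : numRadius ℂ P ≤ v := by
  refine Real.sSup_le ?_ hv
  rintro _ ⟨c, ⟨x, f, hx, hf, hfx, hc⟩, rfl⟩
  by_contra! hlt
  have hB : 0 < ‖c‖ := hv.trans_lt hlt
  have hn1 : (1 : ℝ) ≤ n := by exact_mod_cast Nat.one_le_iff_ne_zero.2 hn
  set B := ‖c‖ with hBdef
  -- Small enough that the second-order term `n * t * B * v` stays below `B - v`.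
  set t := (B - v) / (2 * n * B * (v + 1)) with ht
  have ht0 : 0 < t := div_pos (by linarith) (by positivity)
  have htB : 2 * (n * t * B) * (v + 1) = B - v := by
    rw [ht]; field_simp
  have hntB : 0 < n * t * B := by positivity
  have hvt : n * v * t ≤ 1 := by
    have h1 : B * (n * v * t) ≤ B * 1 := by nlinarith [mul_nonneg hntB.le hv]
    exact le_of_mul_le_mul_left h1 hB
  -- The phase of `h` makes `h * c` the positive number `t * B`.
  set h : ℂ := (t : ℂ) * (starRingEnd ℂ c / (B : ℂ)) with hh
  have hnh : ‖h‖ = t := by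
    rw [hh, norm_mul, norm_div, RCLike.norm_conj, Complex.norm_real, Complex.norm_real, ← hBdef,
      Real.norm_of_nonneg ht0.le, Real.norm_of_nonneg hB.le, div_self hB.ne', mul_one]
  have hhc : h * c = ((t * B : ℝ) : ℂ) := by
    have hBc : (B : ℂ) ≠ 0 := by exact_mod_cast hB.ne'
    have hcc : starRingEnd ℂ c * c = (B : ℂ) * B := by
      rw [mul_comm, Complex.mul_conj, Complex.normSq_eq_norm_sq, ← hBdef]; push_cast; ring
    rw [hh, mul_assoc, div_mul_eq_mul_div, hcc, mul_div_cancel_right₀ _ hBc]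
    push_cast; ring
  have h1 : 1 + t * B ≤ ‖x + h • P x‖ := by
    have h2 : f (x + h • P x) = ((1 + t * B : ℝ) : ℂ) := by
      rw [map_add, map_smul, hfx, ← hc, smul_eq_mul, hhc]; push_cast; ring
    have h3 := f.le_opNorm (x + h • P x)
    rwa [h2, hf, one_mul, Complex.norm_real, Real.norm_of_nonneg (by positivity)] at h3
  have h4 := hP x hx.le h (by rw [hnh]; exact hvt)
  rw [hnh] at h4
  have h5 : 1 + n * (t * B) ≤ ‖x + h • P x‖ ^ n :=
    (one_add_mul_le_pow (by nlinarith [mul_pos ht0 hB]) n).trans (by gcongr)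
  have h6 : (1 + n * (t * B)) * (1 - n * v * t) ≤ 1 :=
    le_trans (mul_le_mul_of_nonneg_right h5 (by linarith)) h4
  have h7 : 0 ≤ n * t * (v + n * t * B * v - B) := by nlinarith
  have h8 : 0 ≤ v + n * t * B * v - B := by
    by_contra! h9
    nlinarith [mul_pos (by positivity : 0 < n * t) (neg_pos.2 h9)]
  nlinarith

theorem polyIndex_le_of_growthBound {n : ℕ} (hn : n ≠ 0) {v : ℝ} (hv : 0 ≤ v)
    (hP : IsHomPoly ℂ k P) (hP1 : polyNorm P = 1) (hg : GrowthBound n v P) :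
    polyIndex ℂ k X ≤ v := by
  refine le_trans (b := numRadius ℂ P) (csInf_le ⟨0, ?_⟩ ⟨P, hP, hP1, rfl⟩)
    (hg.numRadius_le hn hv)
  rintro _ ⟨Q, -, -, rfl⟩
  exact numRadius_nonneg Q

end Growth

/-! ### Polynomials on `c₀`-sums -/

section C0Sum

variable {ι : Type*} {E : ι → Type*} [∀ i, NormedAddCommGroup (E i)] [∀ i, NormedSpace ℂ (E i)]

/-- The coordinate projection of a `c₀`-sum. -/
noncomputable def c0Proj (E : ι → Type*) [∀ i, NormedAddCommGroup (E i)]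
    [∀ i, NormedSpace ℂ (E i)] (i : ι) : c0Sum ℂ E →L[ℂ] E i :=
  (lp.evalCLM ℂ E ∞ i).comp (c0Sum ℂ E).subtypeL

open Classical in
theorem single_mem_c0Sum (i : ι) (x : E i) : lp.single ∞ i x ∈ c0Sum ℂ E := by
  change Tendsto _ _ _
  refine tendsto_const_nhds.congr' ?_
  filter_upwards [(Set.finite_singleton i).compl_mem_cofinite] with j hj
  rw [lp.single_apply_ne _ _ _ hj, norm_zero]

open Classical in
/-- The coordinate inclusion into a `c₀`-sum. -/
noncomputable def c0Single (E : ι → Type*) [∀ i, NormedAddCommGroup (E i)]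
    [∀ i, NormedSpace ℂ (E i)] (i : ι) : E i →L[ℂ] c0Sum ℂ E :=
  (lp.singleContinuousLinearMap ℂ E ∞ i).codRestrict (c0Sum ℂ E) (single_mem_c0Sum i)

open Classical in
theorem c0Proj_c0Single_self (i : ι) (x : E i) : c0Proj E i (c0Single E i x) = x :=
  lp.single_apply_self ∞ i x

open Classical in
theorem c0Proj_c0Single_ne {i j : ι} (hij : j ≠ i) (x : E i) :
    c0Proj E j (c0Single E i x) = 0 :=
  lp.single_apply_ne ∞ i x hij

open Classical in
theorem norm_c0Single (i : ι) (x : E i) : ‖c0Single E i x‖ = ‖x‖ :=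
  lp.norm_single (by simp) _ _

theorem norm_c0Proj_le (i : ι) (x : c0Sum ℂ E) : ‖c0Proj E i x‖ ≤ ‖x‖ :=
  lp.norm_apply_le_norm (by simp) _ _

theorem c0Sum_norm_le {x : c0Sum ℂ E} {C : ℝ} (hC : 0 ≤ C) (h : ∀ i, ‖c0Proj E i x‖ ≤ C) :
    ‖x‖ ≤ C :=
  lp.norm_le_of_forall_le hC h

theorem isClosed_c0Sum : IsClosed (c0Sum ℂ E : Set (lp E ∞)) := by
  refine isClosed_of_closure_subset fun x hx => ?_
  change Tendsto (fun i => ‖x i‖) cofinite (𝓝 0)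
  rw [Metric.tendsto_nhds]
  intro ε hε
  obtain ⟨y, hy, hxy⟩ := Metric.mem_closure_iff.1 hx (ε / 2) (by positivity)
  have hy' : Tendsto (fun i => ‖y i‖) cofinite (𝓝 0) := hy
  filter_upwards [Metric.tendsto_nhds.1 hy' (ε / 2) (by positivity)] with i hi
  rw [dist_zero_right, norm_norm] at hi ⊢
  have h1 : ‖x i - y i‖ ≤ ‖x - y‖ := lp.norm_apply_le_norm (by simp) (x - y) i
  rw [dist_eq_norm] at hxy
  have h2 := norm_add_le (x i - y i) (y i)
  rw [sub_add_cancel] at h2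
  linarith

theorem completeSpace_c0Sum [∀ i, CompleteSpace (E i)] : CompleteSpace (c0Sum ℂ E) :=
  isClosed_c0Sum.completeSpace_coe

/-- A polynomial on one summand, transported to the `c₀`-sum. -/
noncomputable def c0Lift (i : ι) (P : E i → E i) (x : c0Sum ℂ E) : c0Sum ℂ E :=
  c0Single E i (P (c0Proj E i x))

theorem IsHomPoly.c0Lift {k : ℕ} {i : ι} {P : E i → E i} (hP : IsHomPoly ℂ k P) :
    IsHomPoly ℂ k (c0Lift i P) := by
  obtain ⟨A, hA⟩ := hP
  exact ⟨(c0Single E i).compContinuousMultilinearMap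
    (A.compContinuousLinearMap fun _ => c0Proj E i), fun x => by simp [PolyNumIndex.c0Lift, hA]⟩

/-- Coordinates other than `i` do not move and keep norm at most `1`, so only coordinate `i` can
push the norm above `1`. -/
theorem GrowthBound.c0Lift {n : ℕ} {v : ℝ} (hv : 0 ≤ v) {i : ι} {P : E i → E i}
    (hP : GrowthBound n v P) : GrowthBound n v (c0Lift i P) := by
  intro x hx h hh
  have hxi : ‖c0Proj E i x‖ ≤ 1 := (norm_c0Proj_le i x).trans hx
  have hle : ‖x + h • PolyNumIndex.c0Lift i P x‖ ≤
      max 1 ‖c0Proj E i x + h • P (c0Proj E i x)‖ := by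
    refine c0Sum_norm_le (by positivity) fun j => ?_
    rw [map_add, map_smul, PolyNumIndex.c0Lift]
    rcases eq_or_ne j i with rfl | hj
    · rw [c0Proj_c0Single_self]
      exact le_max_right _ _
    · rw [c0Proj_c0Single_ne hj, smul_zero, add_zero]
      exact ((norm_c0Proj_le j x).trans hx).trans (le_max_left _ _)
  have h0 : 0 ≤ 1 - n * v * ‖h‖ := by linarith
  refine (mul_le_mul_of_nonneg_right (pow_le_pow_left₀ (norm_nonneg _) hle n) h0).trans ?_
  rcases max_choice 1 ‖c0Proj E i x + h • P (c0Proj E i x)‖ with e | e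
  · rw [e, one_pow, one_mul]
    have : 0 ≤ n * v * ‖h‖ := by positivity
    linarith
  · rw [e]
    exact hP _ hxi h hh

theorem polyNorm_c0Lift_eq_one {i : ι} {P : E i → E i} (hP : ∀ x, ‖x‖ ≤ 1 → ‖P x‖ ≤ 1)
    (hP1 : ∃ x, ‖x‖ ≤ 1 ∧ ‖P x‖ = 1) : polyNorm (c0Lift i P) = 1 := by
  refine polyNorm_eq_one (fun x hx => ?_) ?_
  · rw [c0Lift, norm_c0Single]
    exact hP _ ((norm_c0Proj_le i x).trans hx)
  · obtain ⟨x, hx, hx1⟩ := hP1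
    exact ⟨c0Single E i x, by rwa [norm_c0Single],
      by rw [c0Lift, norm_c0Single, c0Proj_c0Single_self, hx1]⟩

end C0Sum

/-! ### The weights of the extremal norm -/

section HarrisSpace

/-- The weight of the first coordinate in the norm of the extremal space. -/
noncomputable def fstWeight (k : ℕ) (m : ℝ) : ℝ := (k * m - m ^ k) / (k - 1)

/-- The weight of the second coordinate in the norm of the extremal space. -/
noncomputable def sndWeight (k : ℕ) (m : ℝ) : ℝ := harrisConst k * m ^ k

variable {k : ℕ} {m : ℝ}

theorem fstWeight_nonneg (hk : 2 ≤ k) (hm : m ∈ Set.Icc 1 (extremalRadius k)) :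
    0 ≤ fstWeight k m := by
  have hk2 : (2 : ℝ) ≤ k := by exact_mod_cast hk
  refine div_nonneg ?_ (by linarith)
  have h1 : m ^ (k - 1) ≤ k := by
    rw [← extremalRadius_pow_pred hk]
    exact pow_le_pow_left₀ (by linarith [hm.1]) hm.2 _
  rw [← mul_pow_sub_one (by omega : k ≠ 0) m]
  nlinarith [hm.1]

/-- Bernoulli at `m - 1`. Geometrically, the line with weights at `m` supports the curve `(k - 1) v
p = q - q ^ k` at `q = 1 / m`. -/
theorem mul_sub_pow_le (k : ℕ) (hm : 0 ≤ m) : k * m - m ^ k ≤ k - 1 := by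
  have := one_add_mul_le_pow (a := m - 1) (by linarith) k
  rw [add_sub_cancel] at this
  linarith

theorem fstWeight_le_one (hk : 2 ≤ k) (hm : m ∈ Set.Icc 1 (extremalRadius k)) :
    fstWeight k m ≤ 1 := by
  have hk2 : (2 : ℝ) ≤ k := by exact_mod_cast hk
  rw [fstWeight, div_le_one (by linarith)]
  exact mul_sub_pow_le k (by linarith [hm.1])

theorem fstWeight_one (hk : 2 ≤ k) : fstWeight k 1 = 1 := by
  have hk2 : (2 : ℝ) ≤ k := by exact_mod_cast hk
  rw [fstWeight, one_pow, mul_one, div_self (by linarith)]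

theorem sndWeight_nonneg (hm : m ∈ Set.Icc 1 (extremalRadius k)) : 0 ≤ sndWeight k m :=
  mul_nonneg (harrisConst_pos k).le (pow_nonneg (by linarith [hm.1]) k)

theorem sndWeight_le_one (hk : 2 ≤ k) (hm : m ∈ Set.Icc 1 (extremalRadius k)) :
    sndWeight k m ≤ 1 := by
  rw [sndWeight, ← harrisConst_mul_extremalRadius_pow hk]
  exact mul_le_mul_of_nonneg_left (pow_le_pow_left₀ (by linarith [hm.1]) hm.2 k)
    (harrisConst_pos k).le

theorem sndWeight_extremalRadius (hk : 2 ≤ k) : sndWeight k (extremalRadius k) = 1 :=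
  harrisConst_mul_extremalRadius_pow hk

theorem one_mem_Icc_extremalRadius (hk : 2 ≤ k) : (1 : ℝ) ∈ Set.Icc 1 (extremalRadius k) :=
  ⟨le_rfl, one_le_extremalRadius hk⟩

theorem extremalRadius_mem_Icc (hk : 2 ≤ k) :
    extremalRadius k ∈ Set.Icc 1 (extremalRadius k) :=
  ⟨one_le_extremalRadius hk, le_rfl⟩

/-- The shear `(q, p) ↦ (q, p + t q ^ k)` moves the unit ball cut out by the weights no further
than the scalar flow. -/
theorem weighted_shear_le (hk : 2 ≤ k) {q p t W : ℝ} (hq : 0 ≤ q) (hp : 0 ≤ p) (ht : 0 ≤ t)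
    (hW : 0 < W) (hWt : W ^ (k - 1) * (1 - ((k - 1 : ℕ) : ℝ) * harrisConst k * t) = 1)
    (hball : ∀ m ∈ Set.Icc 1 (extremalRadius k), fstWeight k m * q + sndWeight k m * p ≤ 1)
    (hm : m ∈ Set.Icc 1 (extremalRadius k)) :
    fstWeight k m * q + sndWeight k m * (p + t * q ^ k) ≤ W := by
  have hk2 : (2 : ℝ) ≤ k := by exact_mod_cast hk
  have hc : ((k - 1 : ℕ) : ℝ) = k - 1 := by rw [Nat.cast_sub (by omega), Nat.cast_one]
  have hm0 : 0 < m := by linarith [hm.1]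
  set v := harrisConst k with hv
  have hv0 : 0 < v := harrisConst_pos k
  set M := extremalRadius k with hM
  have hu : 0 < 1 - ((k - 1 : ℕ) : ℝ) * v * t := by
    by_contra! h
    nlinarith [pow_pos hW (k - 1)]
  -- For `q ≤ 1 / M`, the flat part, the shear adds at most `v * t`, and `1 + v * t ≤ W` by
  -- Bernoulli.
  rcases le_or_gt (q * M) 1 with hqM | hqM
  · have h1 : sndWeight k m * (t * q ^ k) ≤ v * t := by
      have : (m * q) ^ k ≤ 1 := pow_le_one₀ (by positivity) (by nlinarith [hm.2])
      rw [mul_pow] at this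
      calc sndWeight k m * (t * q ^ k) = v * t * (m ^ k * q ^ k) := by
            rw [sndWeight]; ring
        _ ≤ v * t * 1 := by gcongr
        _ = v * t := mul_one _
    have h2 : 1 + v * t ≤ W := by
      refine le_of_pow_le_pow_left₀ (by omega : k - 1 ≠ 0) hW.le ?_
      refine le_of_mul_le_mul_right ?_ hu
      rw [hWt, mul_assoc]
      exact one_add_pow_mul_one_sub_le (k - 1) (by positivity) (by rw [← mul_assoc]; linarith)
    have h3 := hball m hm
    linarith
  · have hM1 : 1 ≤ M := one_le_extremalRadius hk
    have hq0 : 0 < q := by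
      by_contra! h
      nlinarith
    have hq1 : q ≤ 1 := by
      have h1 := hball 1 (one_mem_Icc_extremalRadius hk)
      rw [fstWeight_one hk] at h1
      have h2 := mul_nonneg (sndWeight_nonneg (one_mem_Icc_extremalRadius hk)) hp
      linarith
    -- The weights at `q⁻¹` are those of the tangent at abscissa `q`, so they put the point on or
    -- below the curve itself.
    have h1 := hball q⁻¹ ⟨(one_le_inv₀ hq0).2 hq1, by
      rw [inv_le_iff_one_le_mul₀ hq0]; linarith⟩
    have h2 : q ^ k + (k - 1) * v * p ≤ q := by
      rw [fstWeight, sndWeight, ← hv, inv_pow] at h1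
      have hk1 : (k : ℝ) - 1 ≠ 0 := by linarith
      have h3 : ((k : ℝ) - 1) * q ^ k * ((k * q⁻¹ - (q ^ k)⁻¹) / (k - 1) * q
          + v * (q ^ k)⁻¹ * p) = k * q ^ k - q + (k - 1) * v * p := by
        field_simp
      have h4 := mul_le_mul_of_nonneg_left h1
        (mul_nonneg (by linarith) (by positivity) : 0 ≤ ((k : ℝ) - 1) * q ^ k)
      rw [h3] at h4
      linarith
    set w := m * q with hw
    have hw0 : 0 ≤ w := by positivity
    have hwk : w ^ k = m ^ k * q ^ k := mul_pow _ _ _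
    have h5 : (k - 1) * (fstWeight k m * q + sndWeight k m * (p + t * q ^ k)) =
        k * w - m ^ k * q + m ^ k * ((k - 1) * v * p) + (k - 1) * v * t * w ^ k := by
      have hk1 : (k : ℝ) - 1 ≠ 0 := by linarith
      rw [fstWeight, sndWeight, ← hv, hwk]
      field_simp
      ring
    have h6 : m ^ k * (q ^ k + (k - 1) * v * p) ≤ m ^ k * q := by gcongr
    set u := 1 - ((k - 1 : ℕ) : ℝ) * v * t with hudef
    -- The tangent inequality for the curve dilated by `W`: since `W ^ (k - 1) * u = 1`, rescaling
    -- `w` by `W` removes the factor `u`.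
    have h7 : k * w - w ^ k * u ≤ (k - 1) * W := by
      have h8 := mul_le_mul_of_nonneg_left (mul_sub_pow_le k (m := w / W) (by positivity)) hW.le
      have h9 : w ^ k * u = W * (w / W) ^ k := by
        have : w ^ k = (w / W) ^ k * (W * W ^ (k - 1)) := by
          rw [mul_pow_sub_one (by omega : k ≠ 0), ← mul_pow, div_mul_cancel₀ _ hW.ne']
        rw [this]
        calc (w / W) ^ k * (W * W ^ (k - 1)) * u = (w / W) ^ k * W * (W ^ (k - 1) * u) := by ring
          _ = W * (w / W) ^ k := by rw [hWt]; ring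
      have h10 : W * (k * (w / W)) = k * w := by field_simp
      rw [h9]
      linarith
    rw [hudef, hc] at h7
    refine le_of_mul_le_mul_left (?_ : (k - 1) * _ ≤ (k - 1) * W) (by linarith)
    rw [h5]
    nlinarith

/-! ### The extremal spaces and their `c₀`-sum -/

/-- The two-dimensional space attaining Harris's bound of order `k`. -/
def HarrisSpace (_ : {k : ℕ // 2 ≤ k}) : Type := ℂ × ℂ

namespace HarrisSpace

variable {k : {k : ℕ // 2 ≤ k}}

instance : AddCommGroup (HarrisSpace k) := inferInstanceAs (AddCommGroup (ℂ × ℂ))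

instance : Module ℂ (HarrisSpace k) := inferInstanceAs (Module ℂ (ℂ × ℂ))

/-- The first coordinate. -/
def fst : HarrisSpace k →ₗ[ℂ] ℂ := LinearMap.fst ℂ ℂ ℂ

/-- The second coordinate. -/
def snd : HarrisSpace k →ₗ[ℂ] ℂ := LinearMap.snd ℂ ℂ ℂ

/-- The inclusion of the second coordinate axis. -/
def inr : ℂ →ₗ[ℂ] HarrisSpace k := LinearMap.inr ℂ ℂ ℂ

/-- The inclusion of the first coordinate axis. -/
def inl : ℂ →ₗ[ℂ] HarrisSpace k := LinearMap.inl ℂ ℂ ℂ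

@[simp] theorem fst_inr (c : ℂ) : fst (inr c : HarrisSpace k) = 0 := rfl
@[simp] theorem snd_inr (c : ℂ) : snd (inr c : HarrisSpace k) = c := rfl
@[simp] theorem fst_inl (c : ℂ) : fst (inl c : HarrisSpace k) = c := rfl
@[simp] theorem snd_inl (c : ℂ) : snd (inl c : HarrisSpace k) = 0 := rfl

noncomputable instance : Norm (HarrisSpace k) where
  norm z := ⨆ m : Set.Icc 1 (extremalRadius k),
    (fstWeight k m * ‖fst z‖ + sndWeight k m * ‖snd z‖)

theorem bddAbove_weighted (z : HarrisSpace k) :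
    BddAbove (Set.range fun m : Set.Icc 1 (extremalRadius k) =>
      fstWeight k m * ‖fst z‖ + sndWeight k m * ‖snd z‖) := by
  refine ⟨1 * ‖fst z‖ + 1 * ‖snd z‖, ?_⟩
  rintro _ ⟨m, rfl⟩
  dsimp only
  gcongr
  · exact fstWeight_le_one k.2 m.2
  · exact sndWeight_le_one k.2 m.2

theorem weighted_le_norm (z : HarrisSpace k) {m : ℝ} (hm : m ∈ Set.Icc 1 (extremalRadius k)) :
    fstWeight k m * ‖fst z‖ + sndWeight k m * ‖snd z‖ ≤ ‖z‖ :=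
  le_ciSup (bddAbove_weighted z) ⟨m, hm⟩

theorem norm_le {z : HarrisSpace k} {C : ℝ} (h : ∀ m ∈ Set.Icc 1 (extremalRadius k),
    fstWeight k m * ‖fst z‖ + sndWeight k m * ‖snd z‖ ≤ C) : ‖z‖ ≤ C :=
  haveI : Nonempty (Set.Icc 1 (extremalRadius k)) := ⟨⟨1, one_mem_Icc_extremalRadius k.2⟩⟩
  ciSup_le fun m => h m m.2

theorem norm_fst_le (z : HarrisSpace k) : ‖fst z‖ ≤ ‖z‖ := by
  have hm := one_mem_Icc_extremalRadius k.2
  have h := weighted_le_norm z hm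
  rw [fstWeight_one k.2, one_mul] at h
  linarith [mul_nonneg (sndWeight_nonneg hm) (norm_nonneg (snd z))]

theorem norm_snd_le (z : HarrisSpace k) : ‖snd z‖ ≤ ‖z‖ := by
  have hm := extremalRadius_mem_Icc k.2
  have h := weighted_le_norm z hm
  rw [sndWeight_extremalRadius k.2, one_mul] at h
  linarith [mul_nonneg (fstWeight_nonneg k.2 hm) (norm_nonneg (fst z))]

theorem normCore : NormedSpace.Core ℂ (HarrisSpace k) where
  norm_nonneg z := (norm_nonneg _).trans (norm_fst_le z)
  norm_smul c z := by
    change (⨆ m : Set.Icc 1 (extremalRadius k), _) = ‖c‖ * ⨆ m : Set.Icc 1 (extremalRadius k), _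
    rw [Real.mul_iSup_of_nonneg (norm_nonneg c)]
    refine iSup_congr fun m => ?_
    rw [map_smul, map_smul, norm_smul, norm_smul]
    ring
  norm_triangle x y := by
    refine norm_le fun m hm => ?_
    have h1 := weighted_le_norm x hm
    have h2 := weighted_le_norm y hm
    rw [map_add, map_add]
    have h3 := mul_le_mul_of_nonneg_left (norm_add_le (fst x) (fst y)) (fstWeight_nonneg k.2 hm)
    have h4 := mul_le_mul_of_nonneg_left (norm_add_le (snd x) (snd y)) (sndWeight_nonneg hm)
    linarith
  norm_eq_zero_iff x := by
    refine ⟨fun h => Prod.ext ?_ ?_, ?_⟩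
    · exact norm_le_zero_iff.1 ((norm_fst_le x).trans h.le)
    · exact norm_le_zero_iff.1 ((norm_snd_le x).trans h.le)
    · rintro rfl
      exact le_antisymm (norm_le fun m _ => by simp) ((norm_nonneg _).trans (norm_fst_le _))

noncomputable instance : NormedAddCommGroup (HarrisSpace k) := NormedAddCommGroup.ofCore normCore

noncomputable instance : NormedSpace ℂ (HarrisSpace k) := NormedSpace.ofCore normCore

theorem finrank_eq_two : Module.finrank ℂ (HarrisSpace k) = 2 := by
  change Module.finrank ℂ (ℂ × ℂ) = 2
  simp

instance : FiniteDimensional ℂ (HarrisSpace k) :=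
  Module.finite_of_finrank_pos (by rw [finrank_eq_two]; norm_num)

instance : CompleteSpace (HarrisSpace k) := FiniteDimensional.complete ℂ _

instance : Nontrivial (HarrisSpace k) := inferInstanceAs (Nontrivial (ℂ × ℂ))

theorem norm_inr (c : ℂ) : ‖(inr c : HarrisSpace k)‖ = ‖c‖ := by
  refine le_antisymm (norm_le fun m hm => ?_) ?_
  · rw [fst_inr, snd_inr, norm_zero, mul_zero, zero_add]
    exact mul_le_of_le_one_left (norm_nonneg c) (sndWeight_le_one k.2 hm)
  · simpa using norm_snd_le (inr c : HarrisSpace k)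

theorem norm_inl (c : ℂ) : ‖(inl c : HarrisSpace k)‖ = ‖c‖ := by
  refine le_antisymm (norm_le fun m hm => ?_) ?_
  · rw [fst_inl, snd_inl, norm_zero, mul_zero, add_zero]
    exact mul_le_of_le_one_left (norm_nonneg c) (fstWeight_le_one k.2 hm)
  · simpa using norm_fst_le (inl c : HarrisSpace k)

/-- The extremal polynomial `(x, y) ↦ (0, x ^ k)`. -/
def shear (z : HarrisSpace k) : HarrisSpace k := inr (fst z ^ (k : ℕ))

theorem isHomPoly_shear : IsHomPoly ℂ (k : ℕ) (shear (k := k)) := by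
  refine ⟨(inr.compMultilinearMap
    ((MultilinearMap.mkPiAlgebraFin ℂ (k : ℕ) ℂ).compLinearMap fun _ => fst)).mkContinuous 1
      fun z => ?_, fun z => ?_⟩
  · rw [LinearMap.compMultilinearMap_apply, norm_inr,
      MultilinearMap.compLinearMap_apply, MultilinearMap.mkPiAlgebraFin_apply, List.prod_ofFn,
      norm_prod, one_mul]
    exact Finset.prod_le_prod (fun _ _ => norm_nonneg _) fun i _ => norm_fst_le (z i)
  · simp [shear]

theorem norm_shear_le {z : HarrisSpace k} (hz : ‖z‖ ≤ 1) : ‖shear z‖ ≤ 1 := by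
  rw [shear, norm_inr, norm_pow]
  exact pow_le_one₀ (norm_nonneg _) ((norm_fst_le z).trans hz)

theorem exists_norm_shear_eq_one : ∃ z : HarrisSpace k, ‖z‖ ≤ 1 ∧ ‖shear z‖ = 1 :=
  ⟨inl 1, by simp [norm_inl], by simp [shear, norm_inr]⟩

/-- The norm depends monotonically on the moduli of the coordinates, so the triangle inequality
reduces the complex shear to the real one in `weighted_shear_le`. -/
theorem growthBound_shear : GrowthBound ((k : ℕ) - 1) (harrisConst k) (shear (k := k)) := by
  intro z hz h hh
  have hk := k.2
  rcases hh.eq_or_lt with hh | hh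
  · rw [hh, sub_self, mul_zero]
    exact zero_le_one
  set u := 1 - (((k : ℕ) - 1 : ℕ) : ℝ) * harrisConst k * ‖h‖ with hu
  have hu0 : 0 < u := by linarith
  -- `W` is the value at time `‖h‖` of the scalar solution; the blow-up time `u = 0` was treated
  -- above.
  obtain ⟨W, hW0, hW⟩ : ∃ W : ℝ, 0 < W ∧ W ^ ((k : ℕ) - 1) = u⁻¹ :=
    ⟨u⁻¹ ^ ((((k : ℕ) - 1 : ℕ) : ℝ)⁻¹), by positivity,
      Real.rpow_inv_natCast_pow (by positivity) (by omega)⟩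
  have hWu : W ^ ((k : ℕ) - 1) * u = 1 := by rw [hW, inv_mul_cancel₀ hu0.ne']
  rw [← hWu]
  refine mul_le_mul_of_nonneg_right (pow_le_pow_left₀ (norm_nonneg _) ?_ _) hu0.le
  refine norm_le fun m hm => ?_
  refine le_trans ?_ (weighted_shear_le hk (norm_nonneg (fst z)) (norm_nonneg (snd z))
    (norm_nonneg h) hW0 hWu (fun m hm => (weighted_le_norm z hm).trans hz) hm)
  have h1 : fst (z + h • shear z) = fst z := by simp [shear]
  have h2 : ‖snd (z + h • shear z)‖ ≤ ‖snd z‖ + ‖h‖ * ‖fst z‖ ^ (k : ℕ) := by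
    rw [map_add, map_smul, shear, snd_inr]
    refine (norm_add_le _ _).trans_eq ?_
    rw [norm_smul, norm_pow]
  rw [h1]
  exact add_le_add_right (mul_le_mul_of_nonneg_left h2 (sndWeight_nonneg hm)) _

theorem polyIndex_eq : polyIndex ℂ (k : ℕ) (HarrisSpace k) = harrisConst k := by
  have hk := k.2
  exact le_antisymm (polyIndex_le_of_growthBound (by omega) (harrisConst_pos k).le
    isHomPoly_shear (polyNorm_eq_one (fun _ => norm_shear_le) exists_norm_shear_eq_one)
    growthBound_shear) (harrisConst_le_polyIndex _ hk)

theorem nontrivial_c0Sum (k : {k : ℕ // 2 ≤ k}) : Nontrivial (c0Sum ℂ HarrisSpace) := by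
  refine ⟨c0Single HarrisSpace k (inl 1), 0, fun h => ?_⟩
  have := norm_c0Single k (inl 1 : HarrisSpace k)
  rw [h, norm_zero, norm_inl, norm_one] at this
  exact zero_ne_one this

theorem polyIndex_c0Sum_eq {k : ℕ} (hk : 2 ≤ k) :
    polyIndex ℂ k (c0Sum ℂ HarrisSpace) = harrisConst k := by
  have := nontrivial_c0Sum ⟨k, hk⟩
  exact le_antisymm (polyIndex_le_of_growthBound (n := k - 1) (by omega) (harrisConst_pos k).le
    (isHomPoly_shear (k := ⟨k, hk⟩)).c0Lift
    (polyNorm_c0Lift_eq_one (fun _ => norm_shear_le) exists_norm_shear_eq_one)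
    (growthBound_shear.c0Lift (harrisConst_pos k).le)) (harrisConst_le_polyIndex _ hk)

end HarrisSpace

end HarrisSpace

end PolyNumIndex

theorem mainTheorem3 :
    (∃ (X : {k : ℕ // 2 ≤ k} → Type) (_ : ∀ k, NormedAddCommGroup (X k))
        (_ : ∀ k, NormedSpace ℂ (X k)),
      (∀ k : {k : ℕ // 2 ≤ k}, Module.finrank ℂ (X k) = 2 ∧
        PolyNumIndex.polyIndex ℂ (k : ℕ) (X k) =
          Real.exp (((k : ℕ) : ℝ) * Real.log ((k : ℕ) : ℝ) / (1 - ((k : ℕ) : ℝ)))) ∧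
      CompleteSpace (PolyNumIndex.c0Sum ℂ X) ∧
      ∀ k : ℕ, 2 ≤ k →
        PolyNumIndex.polyIndex ℂ k (PolyNumIndex.c0Sum ℂ X) =
          Real.exp ((k : ℝ) * Real.log (k : ℝ) / (1 - (k : ℝ)))) ∧
    (∀ (Y : Type*) [NormedAddCommGroup Y] [NormedSpace ℂ Y] [CompleteSpace Y] [Nontrivial Y]
        (k : ℕ), 2 ≤ k →
      Real.exp ((k : ℝ) * Real.log (k : ℝ) / (1 - (k : ℝ))) ≤
        PolyNumIndex.polyIndex ℂ k Y) := by
  refine ⟨⟨PolyNumIndex.HarrisSpace, inferInstance, inferInstance,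
    fun k => ⟨PolyNumIndex.HarrisSpace.finrank_eq_two, PolyNumIndex.HarrisSpace.polyIndex_eq⟩,
    PolyNumIndex.completeSpace_c0Sum,
    fun k hk => PolyNumIndex.HarrisSpace.polyIndex_c0Sum_eq hk⟩, ?_⟩
  intro Y _ _ _ _ k hk
  exact PolyNumIndex.harrisConst_le_polyIndex Y hk
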